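/- Let $n\ge 1$ and let $|\cdot|$ denote volume in $\mathbb{R}^n$. A convex body is a convex compact subset of $\mathbb{R}^n$ with nonempty interior, and $\mathcal{K}_0$ is the set of convex bodies with the origin in their interior. For a convex body $K$ put $h_K(u)=\max_{x\in K}\langle x,u\rangle$ for $u\in S^{n-1}$ and $K^\circ=\{y:\langle x,y\rangle\le 1\ \forall x\in K\}$. Let $S(K,\cdot)$ be the surface area measure of $K$, i.e. the finite positive Borel measure on $S^{n-1}$ such that $$\lim_{\varepsilon\to 0^+}\frac{|K+\varepsilon L|-|K|}{n\varepsilon}=\frac1n\int_{S^{n-1}}h_L(u)\,dS(K,u)\quad\text{for all convex bodies } L.$$ For $p\in\mathbb{R}$ and $K,Q\in\mathcal{K}_0$ let $$V_p(K,Q)=\frac1n\int_{S^{n-1}}h_Q(u)^p\,h_K(u)^{1-p}\,dS(K,u).$$ For $p\in\mathbb{R}$ with $p\ne -n$ and $K\in\mathcal{K}_0$, the $L_p$ geominimal surface area $\tilde G_p(K)\in[0,\infty]$ is $$\tilde G_p(K)=\inf_{Q\in\mathcal{K}_0}\Big\{n\,V_p(K,Q)^{\frac{n}{n+p}}\,|Q^\circ|^{\frac{p}{n+p}}\Big\}\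 \text{ if } p\ge 0,\qquad \tilde G_p(K)=\sup_{Q\in\mathcal{K}_0}\Big\{n\,V_p(K,Q)^{\frac{n}{n+p}}\,|Q^\circ|^{\frac{p}{n+p}}\Big\}\ \text{ if } -n\ne p<0.$$ **Proposition.** Let $K\in\mathcal{K}_0$. For every real $p\ne -n$ and every invertible linear map $T:\mathbb{R}^n\to\mathbb{R}^n$, $$\tilde G_p(TK)=|\det T|^{\frac{n-p}{n+p}}\,\tilde G_p(K)$$ (with $c\cdot\infty=\infty$ for $c>0$). In particular, $\tilde G_p(TK)=\tilde G_p(K)$ whenever $|\det T|=1$. -/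

import Mathlib

open MeasureTheory Filter Topology
open scoped Pointwise ENNReal

namespace Geominimal

/-- The Euclidean space `ℝⁿ`. -/
abbrev E (n : ℕ) : Type := EuclideanSpace ℝ (Fin n)

/-- The Euclidean unit sphere `Sⁿ⁻¹`, as a type. -/
abbrev S (n : ℕ) : Type := Metric.sphere (0 : E n) 1

/-- A convex body: a convex compact subset of `ℝⁿ` with nonempty interior. -/
structure IsConvexBody {n : ℕ} (K : Set (E n)) : Prop where
  convex : Convex ℝ K
  isCompact : IsCompact K
  interior_nonempty : (interior K).Nonempty

/-- The class `𝒦₀` of convex bodies with the origin in their interior. -/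
def K0 (n : ℕ) : Set (Set (E n)) :=
  {K | IsConvexBody K ∧ (0 : E n) ∈ interior K}

/-- The polar body `K° = {y : ⟨x, y⟩ ≤ 1 for all x ∈ K}`. -/
def polarBody {n : ℕ} (K : Set (E n)) : Set (E n) :=
  {y | ∀ x ∈ K, inner ℝ x y ≤ 1}

/-- The support function `h_K(u) = max_{x ∈ K} ⟨x, u⟩`
(the supremum is attained when `K` is compact and nonempty). -/
noncomputable def supportFn {n : ℕ} (K : Set (E n)) (u : E n) : ℝ :=
  sSup ((fun x => inner ℝ x u) '' K)

/-- `HasMixedVolume K L v`: the limit `lim_{ε → 0⁺} (|K + ε L| - |K|) / (n ε)` exists and equals `v`,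
that is, `V₁(K, L) = v`. -/
def HasMixedVolume {n : ℕ} (K L : Set (E n)) (v : ℝ) : Prop :=
  Tendsto (fun ε : ℝ => (volume.real (K + ε • L) - volume.real K) / (n * ε)) (𝓝[>] 0) (𝓝 v)

/-- `μ` is a surface area measure of `K`: a finite positive Borel measure on the sphere with
`V₁(K, L) = (1/n) ∫ h_L dμ` for every convex body `L`. -/
structure IsSurfaceAreaMeasure {n : ℕ} (K : Set (E n)) (μ : Measure (S n)) : Prop where
  finite : IsFiniteMeasure μ
  mixedVolume : ∀ L : Set (E n), IsConvexBody L →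
    HasMixedVolume K L ((1 / (n : ℝ)) * ∫ u : S n, supportFn L u ∂μ)

open Classical in
/-- The surface area measure `S(K, ·)`. Every convex body has exactly one such measure
(Aleksandrov, Fenchel and Jessen); the value `0` is used only for sets that have none. -/
noncomputable def surfaceAreaMeasure {n : ℕ} (K : Set (E n)) : Measure (S n) :=
  if h : ∃ μ : Measure (S n), IsSurfaceAreaMeasure K μ then h.choose else 0

/-- The `p`-surface area measure `dS_p(K, u) = h_K(u)^(1-p) dS(K, u)`, for real `p`. -/
noncomputable def pSurfaceAreaMeasure {n : ℕ} (p : ℝ) (K : Set (E n)) : Measure (S n) :=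
  (surfaceAreaMeasure K).withDensity (fun u => ENNReal.ofReal (supportFn K u ^ (1 - p)))

/-- The `p`-mixed volume `V_p(K, Q) = (1/n) ∫ h_Q(u)^p dS_p(K, u)`, for real `p`. -/
noncomputable def pMixedVolume {n : ℕ} (p : ℝ) (K Q : Set (E n)) : ℝ :=
  (1 / (n : ℝ)) * ∫ u : S n, supportFn Q u ^ p ∂(pSurfaceAreaMeasure p K)

/-- The quantity `n V_p(K, Q)^(n/(n+p)) |Q°|^(p/(n+p))`. -/
noncomputable def geominimalFunctional {n : ℕ} (p : ℝ) (K Q : Set (E n)) : ℝ :=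
  n * pMixedVolume p K Q ^ ((n : ℝ) / (n + p)) * volume.real (polarBody Q) ^ (p / (n + p))

open Classical in
/-- The `L_p` geominimal surface area: the infimum over `Q ∈ 𝒦₀` of
`n V_p(K, Q)^(n/(n+p)) |Q°|^(p/(n+p))` if `p ≥ 0`, and the supremum if `-n ≠ p < 0`.
It takes values in `[0, ∞]`, since the supremum can be infinite. -/
noncomputable def geominimal {n : ℕ} (p : ℝ) (K : Set (E n)) : ℝ≥0∞ :=
  if 0 ≤ p then ⨅ Q ∈ K0 n, ENNReal.ofReal (geominimalFunctional p K Q)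
  else ⨆ Q ∈ K0 n, ENNReal.ofReal (geominimalFunctional p K Q)

end Geominimal

namespace Geominimal

variable {n : ℕ}

/-! The functional itself is equivariant: replacing `(K, Q)` by `(TK, TQ)` multiplies it by |det
T|^((n-p)/(n+p)). Since Q ↦ TQ permutes 𝒦₀, the infimum or supremum scales by the same factor. The
exponent comes from |(TQ)°| = |det T|⁻¹ |Q°| and V_p(TK, TQ) = |det T| V_p(K, Q)
(`pMixedVolume_image`). For the latter, S(TK, ·) is the image of |det T| ‖T⁻ᵗu‖ dS(K, u) under u ↦
T⁻ᵗu/‖T⁻ᵗu‖ (`surfaceAreaMeasure_image`), while h_TK and h_TQ at the image point are h_K(u) and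
h_Q(u) divided by ‖T⁻ᵗu‖; the powers 1 - p and p sum to 1, so the norms cancel. As the surface area
measure is a chosen witness, its transformation law needs uniqueness, which follows from density of
differences of support functions in C(Sⁿ⁻¹). -/

lemma IsConvexBody.nonempty {K : Set (E n)} (hK : IsConvexBody K) : K.Nonempty :=
  hK.interior_nonempty.mono interior_subset

lemma bddAbove_inner_image {K : Set (E n)} (hK : IsCompact K) (u : E n) :
    BddAbove ((fun x => inner ℝ x u) '' K) :=
  (hK.image (by fun_prop)).bddAbove

/-! ### Support functions -/

lemma continuous_supportFn {K : Set (E n)} (hK : IsCompact K) : Continuous (supportFn K) :=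
  hK.continuous_sSup (f := fun u x => inner ℝ x u) (by fun_prop)

lemma supportFn_le {K : Set (E n)} (hK : K.Nonempty) {u : E n} {c : ℝ}
    (h : ∀ x ∈ K, inner ℝ x u ≤ c) : supportFn K u ≤ c :=
  csSup_le (hK.image _) (by rintro _ ⟨x, hx, rfl⟩; exact h x hx)

lemma inner_le_supportFn {K : Set (E n)} (hK : IsCompact K) {x : E n} (hx : x ∈ K) (u : E n) :
    inner ℝ x u ≤ supportFn K u :=
  le_csSup (bddAbove_inner_image hK u) ⟨x, hx, rfl⟩

lemma supportFn_nonneg {K : Set (E n)} (h0 : (0 : E n) ∈ K) (u : E n) : 0 ≤ supportFn K u :=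
  Real.sSup_nonneg' ⟨0, ⟨0, h0, by simp⟩, le_rfl⟩

lemma supportFn_smul_right (K : Set (E n)) {c : ℝ} (hc : 0 ≤ c) (u : E n) :
    supportFn K (c • u) = c * supportFn K u := by
  rw [supportFn, supportFn, ← smul_eq_mul, ← Real.sSup_smul_of_nonneg hc]
  congr 1
  ext y
  simp [Set.mem_smul_set, inner_smul_right]

lemma supportFn_image (f : E n →ₗ[ℝ] E n) (K : Set (E n)) (u : E n) :
    supportFn (f '' K) u = supportFn K (LinearMap.adjoint f u) := by
  simp only [supportFn, Set.image_image, LinearMap.adjoint_inner_right]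

lemma supportFn_add {K L : Set (E n)} (hK : IsConvexBody K) (hL : IsConvexBody L) (u : E n) :
    supportFn (K + L) u = supportFn K u + supportFn L u := by
  rw [supportFn, supportFn, supportFn, ← csSup_add (hK.nonempty.image _)
    (bddAbove_inner_image hK.isCompact u) (hL.nonempty.image _)
    (bddAbove_inner_image hL.isCompact u)]
  congr 1
  ext y
  simp [Set.mem_add, inner_add_left]

lemma supportFn_closedBall (w : E n) {r : ℝ} (hr : 0 ≤ r) (u : S n) :
    supportFn (Metric.closedBall w r) u = inner ℝ w (u : E n) + r := by
  have hu : ‖(u : E n)‖ = 1 := norm_eq_of_mem_sphere u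
  apply le_antisymm
  · refine supportFn_le ⟨w, Metric.mem_closedBall_self hr⟩ fun x hx => ?_
    have h1 : inner ℝ (x - w) (u : E n) ≤ ‖x - w‖ * ‖(u : E n)‖ := real_inner_le_norm _ _
    rw [inner_sub_left, hu, mul_one] at h1
    rw [mem_closedBall_iff_norm] at hx
    linarith
  · have h := inner_le_supportFn (K := Metric.closedBall w r) (isCompact_closedBall w r)
      (x := w + r • (u : E n))
      (by simp [norm_smul, hu, abs_of_nonneg hr]) (u : E n)
    rwa [inner_add_left, real_inner_smul_left, real_inner_self_eq_norm_sq, hu, one_pow,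
      mul_one] at h

lemma supportFn_closedConvexHull_union {K L : Set (E n)} (hK : IsConvexBody K)
    (hL : IsConvexBody L) (hc : IsCompact (closedConvexHull ℝ (K ∪ L))) (u : E n) :
    supportFn (closedConvexHull ℝ (K ∪ L)) u = max (supportFn K u) (supportFn L u) := by
  have hsub : K ∪ L ⊆ closedConvexHull ℝ (K ∪ L) := subset_closedConvexHull
  apply le_antisymm
  · refine supportFn_le ((hK.nonempty.mono Set.subset_union_left).mono hsub) fun x hx => ?_
    have hmin : closedConvexHull ℝ (K ∪ L) ⊆
        {x | inner ℝ x u ≤ max (supportFn K u) (supportFn L u)} := by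
      refine closedConvexHull_min ?_ ?_ ?_
      · rintro x (hx | hx)
        · exact (inner_le_supportFn hK.isCompact hx u).trans (le_max_left _ _)
        · exact (inner_le_supportFn hL.isCompact hx u).trans (le_max_right _ _)
      · exact convex_halfSpace_le ⟨fun x y => inner_add_left x y u,
          fun c x => real_inner_smul_left x u c⟩ _
      · exact isClosed_le (by fun_prop) continuous_const
    exact hmin hx
  · refine max_le (supportFn_le hK.nonempty fun x hx => ?_)
      (supportFn_le hL.nonempty fun x hx => ?_)
    · exact inner_le_supportFn hc (hsub (Or.inl hx)) u
    · exact inner_le_supportFn hc (hsub (Or.inr hx)) u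

/-! ### Operations on convex bodies -/

lemma IsConvexBody.add {K L : Set (E n)} (hK : IsConvexBody K) (hL : IsConvexBody L) :
    IsConvexBody (K + L) where
  convex := hK.convex.add hL.convex
  isCompact := hK.isCompact.add hL.isCompact
  interior_nonempty := (hK.interior_nonempty.add hL.nonempty).mono <|
    interior_maximal (Set.add_subset_add_right interior_subset) isOpen_interior.add_right

lemma isConvexBody_closedBall (w : E n) {r : ℝ} (hr : 0 < r) :
    IsConvexBody (Metric.closedBall w r) where
  convex := convex_closedBall w r
  isCompact := isCompact_closedBall w r
  interior_nonempty := ⟨w, Metric.ball_subset_interior_closedBall (Metric.mem_ball_self hr)⟩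

lemma IsConvexBody.closedConvexHull_union {K L : Set (E n)} (hK : IsConvexBody K)
    (hL : IsConvexBody L) : IsConvexBody (closedConvexHull ℝ (K ∪ L)) where
  convex := convex_closedConvexHull
  isCompact := by
    refine Metric.isCompact_of_isClosed_isBounded isClosed_closedConvexHull ?_
    rw [closedConvexHull_eq_closure_convexHull]
    exact (isBounded_convexHull.2 (hK.isCompact.union hL.isCompact).isBounded).closure
  interior_nonempty := hK.interior_nonempty.mono <|
    interior_mono (Set.subset_union_left.trans subset_closedConvexHull)

lemma interior_image_linearEquiv (T : E n ≃ₗ[ℝ] E n) (K : Set (E n)) :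
    interior (T '' K) = T '' interior K :=
  (T.toContinuousLinearEquiv.toHomeomorph.image_interior K).symm

lemma IsConvexBody.image {K : Set (E n)} (hK : IsConvexBody K) (T : E n ≃ₗ[ℝ] E n) :
    IsConvexBody (T '' K) where
  convex := hK.convex.linear_image (T : E n →ₗ[ℝ] E n)
  isCompact := hK.isCompact.image T.toContinuousLinearEquiv.continuous
  interior_nonempty := by
    rw [interior_image_linearEquiv]
    exact hK.interior_nonempty.image T

lemma image_mem_K0 {K : Set (E n)} (hK : K ∈ K0 n) (T : E n ≃ₗ[ℝ] E n) : T '' K ∈ K0 n :=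
  ⟨hK.1.image T, by rw [interior_image_linearEquiv]; exact ⟨0, hK.2, map_zero T⟩⟩

lemma image_symm_image (T : E n ≃ₗ[ℝ] E n) (K : Set (E n)) : T.symm '' (T '' K) = K := by
  simp [Set.image_image]

lemma image_image_symm (T : E n ≃ₗ[ℝ] E n) (K : Set (E n)) : T '' (T.symm '' K) = K := by
  simp [Set.image_image]

/-! ### Uniqueness of the surface area measure -/

/-- The continuous functions on the sphere that are differences of support functions
of convex bodies. -/
def supportDifferences (n : ℕ) : Set C(S n, ℝ) :=
  {f | ∃ K L : Set (E n), IsConvexBody K ∧ IsConvexBody L ∧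
    ∀ u : S n, f u = supportFn K u - supportFn L u}

lemma exists_supportDifference_eq_affine (w : E n) (c : ℝ) :
    ∃ f ∈ supportDifferences n, ∀ u : S n, f u = inner ℝ w (u : E n) + c := by
  refine ⟨⟨fun u => inner ℝ w (u : E n) + c, by fun_prop⟩,
    -- The radii differ by `c`, and adding `|c| + 1` keeps both positive.
    ⟨Metric.closedBall w (|c| + 1 + c), Metric.closedBall 0 (|c| + 1),
      isConvexBody_closedBall _ (by linarith [neg_abs_le c]),
      isConvexBody_closedBall _ (by positivity), fun u => ?_⟩, fun u => rfl⟩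
  rw [supportFn_closedBall _ (by linarith [neg_abs_le c]), supportFn_closedBall _ (by positivity),
    inner_zero_left]
  simp only [ContinuousMap.coe_mk]
  ring

/-- Lattice form of Stone–Weierstrass. Stability under min and max comes from min(a - b, c - d) = (a
+ c) - max(a + d, c + b) and max(a - b, c - d) = max(a + d, c + b) - (b + d), where sums and maxima
of support functions belong to Minkowski sums and hulls of unions. -/
lemma closure_supportDifferences (n : ℕ) : closure (supportDifferences n) = ⊤ := by
  apply ContinuousMap.sublattice_closure_eq_top
  · obtain ⟨f, hf, -⟩ := exists_supportDifference_eq_affine (0 : E n) 0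
    exact ⟨f, hf⟩
  · rintro f ⟨A, B, hA, hB, hf⟩ g ⟨C, D, hC, hD, hg⟩
    refine ⟨A + C, closedConvexHull ℝ ((A + D) ∪ (C + B)), hA.add hC,
      (hA.add hD).closedConvexHull_union (hC.add hB), fun u => ?_⟩
    rw [supportFn_closedConvexHull_union (hA.add hD) (hC.add hB)
      ((hA.add hD).closedConvexHull_union (hC.add hB)).isCompact, supportFn_add hA hC,
      supportFn_add hA hD, supportFn_add hC hB, ContinuousMap.inf_apply, hf, hg]
    grind
  · rintro f ⟨A, B, hA, hB, hf⟩ g ⟨C, D, hC, hD, hg⟩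
    refine ⟨closedConvexHull ℝ ((A + D) ∪ (C + B)), B + D,
      (hA.add hD).closedConvexHull_union (hC.add hB), hB.add hD, fun u => ?_⟩
    rw [supportFn_closedConvexHull_union (hA.add hD) (hC.add hB)
      ((hA.add hD).closedConvexHull_union (hC.add hB)).isCompact, supportFn_add hB hD,
      supportFn_add hA hD, supportFn_add hC hB, ContinuousMap.sup_apply, hf, hg]
    grind
  · intro v x y
    by_cases hxy : x = y
    · obtain ⟨f, hf, h⟩ := exists_supportDifference_eq_affine (0 : E n) (v x)
      exact ⟨f, hf, by simp [h], by simp [h, hxy]⟩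
    · have hd : inner ℝ ((x : E n) - y) ((x : E n) - y) ≠ (0 : ℝ) := by
        rw [inner_self_ne_zero, sub_ne_zero]
        exact fun h => hxy (Subtype.ext h)
      set d : ℝ := inner ℝ ((x : E n) - y) ((x : E n) - y) with hd_def
      -- Scaled so that ⟨w, x - y⟩ = v x - v y; a constant then fixes the value at `x`.
      set w : E n := ((v x - v y) / d) • ((x : E n) - y) with hw
      have hw' : inner ℝ w (x : E n) - inner ℝ w (y : E n) = v x - v y := by
        rw [← inner_sub_right, hw, real_inner_smul_left, ← hd_def, div_mul_cancel₀ _ hd]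
      obtain ⟨f, hf, h⟩ := exists_supportDifference_eq_affine w (v x - inner ℝ w (x : E n))
      exact ⟨f, hf, by rw [h]; ring, by rw [h]; linarith⟩

/-- A finite measure on the sphere is determined by its integrals of support functions. -/
lemma measure_ext_of_integral_supportFn {μ ν : Measure (S n)} [IsFiniteMeasure μ]
    [IsFiniteMeasure ν]
    (h : ∀ L : Set (E n), IsConvexBody L →
      ∫ u : S n, supportFn L u ∂μ = ∫ u : S n, supportFn L u ∂ν) : μ = ν := by
  have hcont : ∀ (ρ : Measure (S n)) [IsFiniteMeasure ρ],
      Continuous fun f : C(S n, ℝ) => ∫ u, f u ∂ρ := by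
    intro ρ _
    have := continuous_integral.comp (ContinuousMap.toLp (E := ℝ) 1 ρ ℝ).continuous
    refine this.congr fun f => integral_congr_ae (ContinuousMap.coeFn_toLp ρ f)
  have hint : ∀ (ρ : Measure (S n)) [IsFiniteMeasure ρ] (f : S n → ℝ), Continuous f →
      Integrable f ρ := fun ρ _ f hf =>
    hf.integrable_of_hasCompactSupport (HasCompactSupport.of_compactSpace f)
  have hclosed : IsClosed {f : C(S n, ℝ) | ∫ u, f u ∂μ = ∫ u, f u ∂ν} :=
    isClosed_eq (hcont μ) (hcont ν)
  have hsub : supportDifferences n ⊆ {f : C(S n, ℝ) | ∫ u, f u ∂μ = ∫ u, f u ∂ν} := by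
    rintro f ⟨K, L, hK, hL, hf⟩
    have hi : ∀ (ρ : Measure (S n)) [IsFiniteMeasure ρ] {M : Set (E n)}, IsConvexBody M →
        Integrable (fun u : S n => supportFn M u) ρ := fun ρ _ M hM =>
      hint ρ _ ((continuous_supportFn hM.isCompact).comp continuous_subtype_val)
    simp only [Set.mem_ofPred_eq, hf]
    rw [integral_sub (hi μ hK) (hi μ hL), integral_sub (hi ν hK) (hi ν hL), h K hK, h L hL]
  have htop := closure_minimal hsub hclosed
  rw [closure_supportDifferences] at htop
  exact ext_of_forall_integral_eq_of_IsFiniteMeasure fun f => htop (Set.mem_univ f.toContinuousMap)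

lemma IsSurfaceAreaMeasure.unique {K : Set (E n)} {μ ν : Measure (S n)}
    (hμ : IsSurfaceAreaMeasure K μ) (hν : IsSurfaceAreaMeasure K ν) : μ = ν := by
  have := hμ.finite
  have := hν.finite
  -- For `n = 0` the factor 1/n is 0 and cannot be cancelled, but the sphere is empty.
  rcases Nat.eq_zero_or_pos n with rfl | hn
  · have : IsEmpty (S 0) := ⟨fun u => by
      have := norm_eq_of_mem_sphere u
      rw [Subsingleton.elim (u : E 0) 0, norm_zero] at this
      exact zero_ne_one this⟩
    exact Subsingleton.elim μ ν
  · refine measure_ext_of_integral_supportFn fun L hL => ?_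
    have h := tendsto_nhds_unique (hμ.mixedVolume L hL) (hν.mixedVolume L hL)
    exact mul_left_cancel₀ (by positivity) h

/-! ### Linear images -/

/-- The inverse transpose of an invertible linear map. -/
noncomputable def invTranspose (T : E n ≃ₗ[ℝ] E n) : E n →ₗ[ℝ] E n :=
  LinearMap.adjoint (T.symm : E n →ₗ[ℝ] E n)

lemma adjoint_invTranspose (T : E n ≃ₗ[ℝ] E n) (u : E n) :
    LinearMap.adjoint (T : E n →ₗ[ℝ] E n) (invTranspose T u) = u := by
  refine ext_inner_left ℝ fun x => ?_
  simp [invTranspose, LinearMap.adjoint_inner_right]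

lemma norm_invTranspose_pos (T : E n ≃ₗ[ℝ] E n) (u : S n) : 0 < ‖invTranspose T u‖ := by
  rw [norm_pos_iff]
  intro h
  have h1 := adjoint_invTranspose T u
  rw [h, map_zero] at h1
  have h2 := norm_eq_of_mem_sphere u
  rw [← h1, norm_zero] at h2
  exact zero_ne_one h2

lemma continuous_invTranspose (T : E n ≃ₗ[ℝ] E n) :
    Continuous fun u : S n => invTranspose T u :=
  (LinearMap.continuous_of_finiteDimensional _).comp continuous_subtype_val

/-- The map `u ↦ T⁻ᵗ u / ‖T⁻ᵗ u‖` of the sphere. -/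
noncomputable def sphereMap (T : E n ≃ₗ[ℝ] E n) (u : S n) : S n :=
  ⟨‖invTranspose T u‖⁻¹ • invTranspose T u, by
    simp [norm_smul, (norm_invTranspose_pos T u).ne']⟩

lemma continuous_sphereMap (T : E n ≃ₗ[ℝ] E n) : Continuous (sphereMap T) :=
  (((continuous_invTranspose T).norm.inv₀ fun u => (norm_invTranspose_pos T u).ne').smul
    (continuous_invTranspose T)).subtype_mk _

lemma supportFn_sphereMap (T : E n ≃ₗ[ℝ] E n) (K : Set (E n)) (u : S n) :
    supportFn K (sphereMap T u) = ‖invTranspose T u‖⁻¹ * supportFn K (invTranspose T u) :=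
  supportFn_smul_right K (inv_nonneg.2 (norm_nonneg _)) _

lemma supportFn_image_sphereMap (T : E n ≃ₗ[ℝ] E n) (K : Set (E n)) (u : S n) :
    supportFn (T '' K) (sphereMap T u) = ‖invTranspose T u‖⁻¹ * supportFn K u := by
  rw [supportFn_sphereMap]
  congr 1
  exact (supportFn_image (T : E n →ₗ[ℝ] E n) K _).trans (by rw [adjoint_invTranspose])

/-- The absolute value of the determinant of `T`. -/
noncomputable def absDet (T : E n ≃ₗ[ℝ] E n) : ℝ := |LinearMap.det (T : E n →ₗ[ℝ] E n)|

lemma absDet_pos (T : E n ≃ₗ[ℝ] E n) : 0 < absDet T :=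
  abs_pos.2 (LinearEquiv.isUnit_det' T).ne_zero

lemma volume_real_image (T : E n ≃ₗ[ℝ] E n) (K : Set (E n)) :
    volume.real (T '' K) = absDet T * volume.real K := by
  have h := Measure.addHaar_image_linearMap volume (T : E n →ₗ[ℝ] E n) K
  rw [measureReal_def, measureReal_def]
  refine (congrArg ENNReal.toReal h).trans ?_
  rw [ENNReal.toReal_mul, ENNReal.toReal_ofReal (abs_nonneg _), absDet]

lemma volume_real_polarBody_image (T : E n ≃ₗ[ℝ] E n) (Q : Set (E n)) :
    volume.real (polarBody (T '' Q)) = (absDet T)⁻¹ * volume.real (polarBody Q) := by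
  have hdet : LinearMap.det (LinearMap.adjoint (T : E n →ₗ[ℝ] E n)) =
      LinearMap.det (T : E n →ₗ[ℝ] E n) := by
    let b := stdOrthonormalBasis ℝ (E n)
    rw [← LinearMap.det_toMatrix b.toBasis, LinearMap.toMatrix_adjoint,
      Matrix.det_conjTranspose, LinearMap.det_toMatrix, star_trivial]
  have hne := (LinearEquiv.isUnit_det' T).ne_zero
  have hset : polarBody (T '' Q) =
      LinearMap.adjoint (T : E n →ₗ[ℝ] E n) ⁻¹' polarBody Q := by
    ext y
    simp [polarBody, LinearMap.adjoint_inner_right]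
  rw [hset, measureReal_def, measureReal_def, Measure.addHaar_preimage_linearMap volume
    (hdet.symm ▸ hne), ENNReal.toReal_mul, ENNReal.toReal_ofReal (abs_nonneg _), hdet, abs_inv,
    absDet]

/-- TK + εL = T(K + εT⁻¹L), so each difference quotient scales by |det T|. -/
lemma HasMixedVolume.image {K L : Set (E n)} {v : ℝ} (T : E n ≃ₗ[ℝ] E n)
    (h : HasMixedVolume K (T.symm '' L) v) : HasMixedVolume (T '' K) L (absDet T * v) := by
  refine (Tendsto.const_mul (absDet T) h).congr fun ε => ?_
  have hset : T '' K + ε • L = T '' (K + ε • (T.symm '' L)) := by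
    rw [Set.image_add, image_smul_set, image_image_symm]
  rw [hset, volume_real_image, volume_real_image]
  ring

/-- The image measure on the sphere of a surface area measure under a linear map. -/
noncomputable def transport (T : E n ≃ₗ[ℝ] E n) (μ : Measure (S n)) : Measure (S n) :=
  (μ.withDensity fun u => ENNReal.ofReal (absDet T * ‖invTranspose T u‖)).map (sphereMap T)

lemma transport_zero (T : E n ≃ₗ[ℝ] E n) : transport T 0 = 0 := by
  simp [transport]

lemma isFiniteMeasure_transport (T : E n ≃ₗ[ℝ] E n) (μ : Measure (S n)) [IsFiniteMeasure μ] :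
    IsFiniteMeasure (transport T μ) := by
  have hc : Continuous fun u : S n => absDet T * ‖invTranspose T u‖ :=
    (continuous_invTranspose T).norm.const_mul _
  have := isFiniteMeasure_withDensity_ofReal
    (hc.integrable_of_hasCompactSupport (μ := μ) (HasCompactSupport.of_compactSpace _)).2
  exact Measure.isFiniteMeasure_map _ _

lemma integral_transport (T : E n ≃ₗ[ℝ] E n) (μ : Measure (S n)) {f : S n → ℝ}
    (hf : Measurable f) :
    ∫ u, f u ∂(transport T μ) =
      absDet T * ∫ u, ‖invTranspose T u‖ * f (sphereMap T u) ∂μ := by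
  have hm : Measurable fun u : S n => ENNReal.ofReal (absDet T * ‖invTranspose T u‖) :=
    ((continuous_invTranspose T).norm.measurable.const_mul _).ennreal_ofReal
  rw [transport, integral_map (continuous_sphereMap T).measurable.aemeasurable
    hf.aestronglyMeasurable, integral_withDensity_eq_integral_toReal_smul hm (by simp),
    ← integral_const_mul]
  congr 1
  ext u
  rw [ENNReal.toReal_ofReal (mul_nonneg (absDet_pos T).le (norm_nonneg _)), smul_eq_mul, mul_assoc]

lemma measurable_supportFn_sphere {K : Set (E n)} (hK : IsCompact K) :
    Measurable fun u : S n => supportFn K u :=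
  ((continuous_supportFn hK).comp continuous_subtype_val).measurable

lemma IsSurfaceAreaMeasure.image {K : Set (E n)} {μ : Measure (S n)} (T : E n ≃ₗ[ℝ] E n)
    (h : IsSurfaceAreaMeasure K μ) : IsSurfaceAreaMeasure (T '' K) (transport T μ) where
  finite := have := h.finite; isFiniteMeasure_transport T μ
  mixedVolume L hL := by
    convert (h.mixedVolume (T.symm '' L) (hL.image T.symm)).image T using 1
    rw [integral_transport T μ (measurable_supportFn_sphere hL.isCompact), mul_left_comm]
    congr 3
    ext u
    -- The density ‖T⁻ᵗu‖ undoes the normalisation, leaving h_L(T⁻ᵗu) = h_{T⁻¹L}(u).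
    rw [supportFn_sphereMap, mul_inv_cancel_left₀ (norm_invTranspose_pos T u).ne']
    exact (supportFn_image (T.symm : E n →ₗ[ℝ] E n) L u).symm

lemma surfaceAreaMeasure_eq {K : Set (E n)} {μ : Measure (S n)} (h : IsSurfaceAreaMeasure K μ) :
    surfaceAreaMeasure K = μ := by
  have hex : ∃ μ : Measure (S n), IsSurfaceAreaMeasure K μ := ⟨μ, h⟩
  rw [surfaceAreaMeasure, dif_pos hex]
  exact hex.choose_spec.unique h

/-- Existence of the measure is not needed: by applying `T.symm`, `K` has one exactly when `TK`
does, and otherwise both sides are the default 0. -/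
lemma surfaceAreaMeasure_image (T : E n ≃ₗ[ℝ] E n) (K : Set (E n)) :
    surfaceAreaMeasure (T '' K) = transport T (surfaceAreaMeasure K) := by
  by_cases h : ∃ μ : Measure (S n), IsSurfaceAreaMeasure K μ
  · obtain ⟨μ, hμ⟩ := h
    rw [surfaceAreaMeasure_eq hμ, surfaceAreaMeasure_eq (hμ.image T)]
  · have h' : ¬ ∃ μ : Measure (S n), IsSurfaceAreaMeasure (T '' K) μ := by
      rintro ⟨ν, hν⟩
      have := hν.image T.symm
      rw [image_symm_image] at this
      exact h ⟨_, this⟩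
    rw [surfaceAreaMeasure, surfaceAreaMeasure, dif_neg h, dif_neg h', transport_zero]

/-! ### The geominimal functional -/

lemma pMixedVolume_eq (p : ℝ) {K Q : Set (E n)} (hK : K ∈ K0 n) :
    pMixedVolume p K Q = (1 / (n : ℝ)) *
      ∫ u : S n, supportFn K u ^ (1 - p) * supportFn Q u ^ p ∂(surfaceAreaMeasure K) := by
  rw [pMixedVolume, pSurfaceAreaMeasure, integral_withDensity_eq_integral_toReal_smul
    ((measurable_supportFn_sphere hK.1.isCompact).pow_const _).ennreal_ofReal (by simp)]
  congr 2
  ext u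
  rw [ENNReal.toReal_ofReal (Real.rpow_nonneg (supportFn_nonneg (interior_subset hK.2) _) _),
    smul_eq_mul]

lemma pMixedVolume_nonneg (p : ℝ) (K : Set (E n)) {Q : Set (E n)} (hQ : Q ∈ K0 n) :
    0 ≤ pMixedVolume p K Q :=
  mul_nonneg (by positivity) <| integral_nonneg fun _ =>
    Real.rpow_nonneg (supportFn_nonneg (interior_subset hQ.2) _) _

lemma pMixedVolume_image (p : ℝ) {K Q : Set (E n)} (hK : K ∈ K0 n) (hQ : Q ∈ K0 n)
    (T : E n ≃ₗ[ℝ] E n) :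
    pMixedVolume p (T '' K) (T '' Q) = absDet T * pMixedVolume p K Q := by
  have hTK := image_mem_K0 hK T
  have hTQ := image_mem_K0 hQ T
  rw [pMixedVolume_eq p hTK, pMixedVolume_eq p hK, surfaceAreaMeasure_image,
    integral_transport T _ (((measurable_supportFn_sphere hTK.1.isCompact).pow_const _).fun_mul
      ((measurable_supportFn_sphere hTQ.1.isCompact).pow_const _)), mul_left_comm]
  congr 3
  ext u
  have ha := norm_invTranspose_pos T u
  have hk := supportFn_nonneg (interior_subset hK.2) (u : E n)
  have hq := supportFn_nonneg (interior_subset hQ.2) (u : E n)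
  have hcancel : ‖invTranspose T u‖⁻¹ ^ (1 - p) * ‖invTranspose T u‖⁻¹ ^ p =
      ‖invTranspose T u‖⁻¹ := by
    rw [← Real.rpow_add (inv_pos.2 ha), sub_add_cancel, Real.rpow_one]
  rw [supportFn_image_sphereMap, supportFn_image_sphereMap, Real.mul_rpow (by positivity) hk,
    Real.mul_rpow (by positivity) hq, mul_mul_mul_comm, hcancel, mul_inv_cancel_left₀ ha.ne']

lemma geominimalFunctional_image (p : ℝ) {K Q : Set (E n)} (hK : K ∈ K0 n) (hQ : Q ∈ K0 n)
    (T : E n ≃ₗ[ℝ] E n) :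
    geominimalFunctional p (T '' K) (T '' Q) =
      absDet T ^ (((n : ℝ) - p) / (n + p)) * geominimalFunctional p K Q := by
  have hT := absDet_pos T
  rw [geominimalFunctional, geominimalFunctional, pMixedVolume_image p hK hQ,
    volume_real_polarBody_image, Real.mul_rpow hT.le (pMixedVolume_nonneg p K hQ),
    Real.mul_rpow (inv_nonneg.2 hT.le) measureReal_nonneg, Real.inv_rpow hT.le, sub_div,
    Real.rpow_sub hT]
  ring

/-- The bijection `Q ↦ T Q` of `𝒦₀`. -/
def imageEquiv (T : E n ≃ₗ[ℝ] E n) : K0 n ≃ K0 n where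
  toFun Q := ⟨T '' Q, image_mem_K0 Q.2 T⟩
  invFun Q := ⟨T.symm '' Q, image_mem_K0 Q.2 T.symm⟩
  left_inv Q := Subtype.ext (image_symm_image T Q)
  right_inv Q := Subtype.ext (image_image_symm T Q)

lemma ofReal_geominimalFunctional_image (p : ℝ) {K : Set (E n)} (hK : K ∈ K0 n)
    (T : E n ≃ₗ[ℝ] E n) (Q : K0 n) :
    ENNReal.ofReal (geominimalFunctional p (T '' K) (imageEquiv T Q)) =
      ENNReal.ofReal (absDet T ^ (((n : ℝ) - p) / (n + p))) *
        ENNReal.ofReal (geominimalFunctional p K Q) := by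
  rw [← ENNReal.ofReal_mul (Real.rpow_nonneg (absDet_pos T).le _),
    ← geominimalFunctional_image p hK Q.2]
  rfl

lemma geominimal_image (p : ℝ) {K : Set (E n)} (hK : K ∈ K0 n) (T : E n ≃ₗ[ℝ] E n) :
    geominimal p (T '' K) =
      ENNReal.ofReal (absDet T ^ (((n : ℝ) - p) / (n + p))) * geominimal p K := by
  -- In `ℝ≥0∞` a factor passes through an infimum when it is neither 0 nor ∞; for suprema no
  -- condition is needed.
  have hc : ENNReal.ofReal (absDet T ^ (((n : ℝ) - p) / (n + p))) ≠ 0 :=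
    (ENNReal.ofReal_pos.2 (Real.rpow_pos_of_pos (absDet_pos T) _)).ne'
  unfold geominimal
  split_ifs
  · rw [iInf_subtype', iInf_subtype', ENNReal.mul_iInf_of_ne hc ENNReal.ofReal_ne_top,
      ← (imageEquiv T).iInf_comp]
    exact iInf_congr fun Q => ofReal_geominimalFunctional_image p hK T Q
  · rw [iSup_subtype', iSup_subtype', ENNReal.mul_iSup, ← (imageEquiv T).iSup_comp]
    exact iSup_congr fun Q => ofReal_geominimalFunctional_image p hK T Q

end Geominimal

theorem proposition3p1 {n : ℕ} (K : Set (Geominimal.E n)) (hK : K ∈ Geominimal.K0 n)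
    (p : ℝ) (hp : p ≠ -(n : ℝ)) (T : Geominimal.E n ≃ₗ[ℝ] Geominimal.E n) :
    Geominimal.geominimal p (T '' K) =
        ENNReal.ofReal (|LinearMap.det (T : Geominimal.E n →ₗ[ℝ] Geominimal.E n)| ^
          (((n : ℝ) - p) / ((n : ℝ) + p))) * Geominimal.geominimal p K ∧
      (|LinearMap.det (T : Geominimal.E n →ₗ[ℝ] Geominimal.E n)| = 1 →
        Geominimal.geominimal p (T '' K) = Geominimal.geominimal p K) := by
  have h := Geominimal.geominimal_image p hK T
  rw [Geominimal.absDet] at h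
  exact ⟨h, fun hdet => by rw [h, hdet, Real.one_rpow, ENNReal.ofReal_one, one_mul]⟩
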